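/- By an affine algebraic set we mean the set $X\subseteq\mathbb C^n$ of common zeros of a set of polynomials (irreducible or not), with coordinate ring $\mathbb C[X]$ the algebra of functions on $X$ that are restrictions of polynomials; morphisms are the maps given by polynomials. An (affine) algebraic group over $\mathbb C$ is an affine algebraic set $G$ with a group structure whose multiplication $G\times G\to G$ and inversion $G\to G$ are morphisms. An affine $G$-variety is an affine algebraic set $Z$ with an action of $G$ such that $G\times Z\to Z$ is a morphism. A finite-dimensional $G$-module is a finite-dimensional complex vector space with a linear $G$-action whose matrix coefficients lie in $\mathbb C[G]$. We say that $G$ satisfies the Nagata hypothesis if for every finite-dimensional $G$-module $M$ and every $G$-invariant hyperplane (codimension-one linear subspace) $N\subseteq M$ such that $G$ acts trivially on $M/N$, there is a decomposition $M=H\oplus P$ into $G$-submodules, where $H$ is a hyperplane and $G$ acts trivially on $P$. Theorem. Let $G$ be an algebraic group over $\mathbb C$ that satisfies the Nagata hypothesis, and let $Z$ be an affine $G$-variety with coordinate ring $\mathbb C[Z]$. Then the ring of invariants $\mathbb C[Z]^G=\{f\in\mathbb C[Z] : f(g\cdot z)=f(z)\text{ for all } g\in G,\ z\in Z\}$ is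 a finitely generated $\mathbb C$-algebra. -/

import Mathlib

/-- `X ⊆ ℂⁿ` is an affine algebraic set: the set of common zeros of a set of polynomials.
Irreducibility is not required, so that disconnected (e.g. finite) groups are included. -/
def IsAffineAlgebraicSet {n : ℕ} (X : Set (Fin n → ℂ)) : Prop :=
  ∃ S : Set (MvPolynomial (Fin n) ℂ), X = {x | ∀ p ∈ S, MvPolynomial.eval x p = 0}

/-- Restriction of polynomials on `ℂⁿ` to functions on `X ⊆ ℂⁿ`. -/
noncomputable def restrictPoly {n : ℕ} (X : Set (Fin n → ℂ)) : MvPolynomial (Fin n) ℂ →ₐ[ℂ] (X → ℂ) :=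
  AlgHom.pi fun x : X => MvPolynomial.aeval (x : Fin n → ℂ)

/-- The coordinate ring `ℂ[X]`: the algebra of functions `X → ℂ` that are restrictions of
polynomials, i.e. `ℂ[x₁, …, xₙ] / I(X)`. -/
noncomputable def coordRing {n : ℕ} (X : Set (Fin n → ℂ)) : Subalgebra ℂ (X → ℂ) :=
  (restrictPoly X).range

/-- A map `X → Y` between subsets of affine spaces is a morphism if its coordinates are given by
polynomials. -/
def IsPolyMap {n m : ℕ} {X : Set (Fin n → ℂ)} {Y : Set (Fin m → ℂ)} (φ : X → Y) : Prop :=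
  ∃ P : Fin m → MvPolynomial (Fin n) ℂ,
    ∀ (x : X) (i : Fin m), (φ x : Fin m → ℂ) i = MvPolynomial.eval (x : Fin n → ℂ) (P i)

/-- A map `X × Y → W`, where `X × Y ⊆ ℂⁿ × ℂᵐ`, is a morphism if its coordinates are given by
polynomials in the `n + m` coordinates. -/
def IsPolyMap₂ {n m k : ℕ} {X : Set (Fin n → ℂ)} {Y : Set (Fin m → ℂ)} {W : Set (Fin k → ℂ)}
    (φ : X → Y → W) : Prop :=
  ∃ P : Fin k → MvPolynomial (Fin n ⊕ Fin m) ℂ,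
    ∀ (x : X) (y : Y) (i : Fin k), (φ x y : Fin k → ℂ) i =
      MvPolynomial.eval (Sum.elim (x : Fin n → ℂ) (y : Fin m → ℂ)) (P i)

/-- `G`, with its group structure, is an (affine) algebraic group over `ℂ`: it is an affine
algebraic set, and multiplication and inversion are morphisms. -/
structure IsAlgebraicGroup {n : ℕ} (G : Set (Fin n → ℂ)) [Group G] : Prop where
  isAffine : IsAffineAlgebraicSet G
  mul_isPolyMap : IsPolyMap₂ (fun g h : G => g * h)
  inv_isPolyMap : IsPolyMap (fun g : G => g⁻¹)

/-- `Z`, with its action of `G`, is an affine `G`-variety: `Z` is an affine algebraic set and the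
action map `G × Z → Z` is a morphism. -/
structure IsAffineGVariety {n m : ℕ} (G : Set (Fin n → ℂ)) [Group G] (Z : Set (Fin m → ℂ))
    [MulAction G Z] : Prop where
  isAffine : IsAffineAlgebraicSet Z
  smul_isPolyMap : IsPolyMap₂ (fun (g : G) (z : Z) => g • z)

/-- A representation of an algebraic group `G` is algebraic (rational) if its matrix coefficients
are regular functions on `G`. -/
def IsAlgebraicRep {n : ℕ} {G : Set (Fin n → ℂ)} [Group G] {M : Type} [AddCommGroup M]
    [Module ℂ M] (ρ : Representation ℂ G M) : Prop :=
  ∀ (v : M) (l : Module.Dual ℂ M), (fun g : G => l (ρ g v)) ∈ coordRing G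

/-- The Nagata hypothesis: for every finite-dimensional algebraic `G`-module `M` and every
`G`-invariant hyperplane `N ⊆ M` such that `G` acts trivially on the line `M / N`, there is a
decomposition `M = H ⊕ P` into `G`-submodules with `H` a hyperplane and `P` (a line) on which `G`
acts trivially. -/
def NagataHypothesis {n : ℕ} (G : Set (Fin n → ℂ)) [Group G] : Prop :=
  ∀ (M : Type) [AddCommGroup M] [Module ℂ M] [FiniteDimensional ℂ M] (ρ : Representation ℂ G M),
    IsAlgebraicRep ρ →
    ∀ N : Submodule ℂ M, Module.finrank ℂ (M ⧸ N) = 1 →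
      (∀ g : G, ∀ v ∈ N, ρ g v ∈ N) →
      (∀ (g : G) (v : M), ρ g v - v ∈ N) →
      ∃ H P : Submodule ℂ M, IsCompl H P ∧ Module.finrank ℂ (M ⧸ H) = 1 ∧
        (∀ g : G, ∀ v ∈ H, ρ g v ∈ H) ∧ (∀ g : G, ∀ v ∈ P, ρ g v = v)

/-- The ring of invariants `ℂ[Z]^G`: the regular functions `f` on `Z` with `f (g • z) = f z`. -/
noncomputable def invariantRing {n m : ℕ} (G : Set (Fin n → ℂ)) [Group G] (Z : Set (Fin m → ℂ))
    [MulAction G Z] : Subalgebra ℂ (coordRing Z) where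
  carrier := {f | ∀ (g : G) (z : Z), (f : Z → ℂ) (g • z) = (f : Z → ℂ) z}
  mul_mem' {a b} ha hb g z := by
    change (a : Z → ℂ) (g • z) * (b : Z → ℂ) (g • z) = (a : Z → ℂ) z * (b : Z → ℂ) z
    rw [ha g z, hb g z]
  add_mem' {a b} ha hb g z := by
    change (a : Z → ℂ) (g • z) + (b : Z → ℂ) (g • z) = (a : Z → ℂ) z + (b : Z → ℂ) z
    rw [ha g z, hb g z]
  algebraMap_mem' _ _ _ := rfl

/-! Invariants lift without a Reynolds operator. Suppose `φ` is linear and constant on the orbit of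
`v`, and `g ↦ ρ g v` is regular. The orbit spans a finite-dimensional algebraic module; if `φ v ≠
0`, then `ker φ` is a hyperplane in it with trivial quotient, so the Nagata hypothesis yields an
invariant vector outside `ker φ`, which rescales to an invariant with the same image as `v`
(`exists_invariant_lift`).

This is used twice. In a polynomial ring with a linear action, finitely many homogeneous invariants
`t` generate the ideal of all those of positive degree. An invariant `p = ∑ a t * t` can be
rewritten with invariant coefficients by lifting, and induction on degree shows that the `t`
generate the algebra (`fixedSubalgebra_fg`). In general, the coordinates of `Z` lie in a
finite-dimensional module `W` of functions, and `Sym W` maps equivariantly onto `ℂ[Z]`; by lifting,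
its invariants map onto `ℂ[Z]^G`. -/

/-! ### Regular maps from `G` to a vector space. -/

section RegularMaps

variable {n : ℕ} {G : Set (Fin n → ℂ)}

/-- The space of regular maps from `G` to a vector space `M`, spanned by the maps `g ↦ a g • m`
with `a ∈ ℂ[G]` and `m ∈ M`; in other words `ℂ[G] ⊗ M`. -/
def regularMaps (G : Set (Fin n → ℂ)) (M : Type*) [AddCommGroup M] [Module ℂ M] :
    Submodule ℂ (G → M) :=
  Submodule.span ℂ {F | ∃ a ∈ coordRing G, ∃ x : M, F = fun g => a g • x}

variable {M N : Type*} [AddCommGroup M] [Module ℂ M] [AddCommGroup N] [Module ℂ N]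

lemma smul_mem_regularMaps {a : G → ℂ} (ha : a ∈ coordRing G) (x : M) :
    (fun g => a g • x) ∈ regularMaps G M :=
  Submodule.subset_span ⟨a, ha, x, rfl⟩

lemma const_mem_regularMaps (x : M) : (fun _ : G => x) ∈ regularMaps G M := by
  simpa using smul_mem_regularMaps (one_mem (coordRing G)) x

lemma linearMap_comp_mem_regularMaps (L : M →ₗ[ℂ] N) {F : G → M} (hF : F ∈ regularMaps G M) :
    (fun g => L (F g)) ∈ regularMaps G N := by
  induction hF using Submodule.span_induction with
  | mem F h =>
    obtain ⟨a, ha, x, rfl⟩ := h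
    simpa using smul_mem_regularMaps ha (L x)
  | zero =>
    simp only [Pi.zero_apply, map_zero]
    exact (regularMaps G N).zero_mem
  | add F F' _ _ h h' =>
    simp only [Pi.add_apply, map_add]
    exact (regularMaps G N).add_mem h h'
  | smul c F _ h =>
    simp only [Pi.smul_apply, map_smul]
    exact (regularMaps G N).smul_mem c h

lemma comp_mem_regularMaps {φ : G → G} (hφ : ∀ a ∈ coordRing G, a ∘ φ ∈ coordRing G)
    {F : G → M} (hF : F ∈ regularMaps G M) : (fun g => F (φ g)) ∈ regularMaps G M := by
  induction hF using Submodule.span_induction with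
  | mem F h =>
    obtain ⟨a, ha, x, rfl⟩ := h
    exact smul_mem_regularMaps (hφ a ha) x
  | zero => exact (regularMaps G M).zero_mem
  | add F F' _ _ h h' => exact (regularMaps G M).add_mem h h'
  | smul c F _ h => exact (regularMaps G M).smul_mem c h

lemma mul_mem_regularMaps {A : Type*} [CommRing A] [Algebra ℂ A] {F F' : G → A}
    (hF : F ∈ regularMaps G A) (hF' : F' ∈ regularMaps G A) : F * F' ∈ regularMaps G A := by
  induction hF, hF' using Submodule.span_induction₂ with
  | mem_mem F F' h h' =>
    obtain ⟨a, ha, x, rfl⟩ := h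
    obtain ⟨b, hb, y, rfl⟩ := h'
    convert smul_mem_regularMaps (mul_mem ha hb) (x * y) using 1
    ext g
    exact smul_mul_smul_comm _ _ _ _
  | zero_left F' _ => simp
  | zero_right F _ => simp
  | add_left F₁ F₂ F' _ _ _ h h' => simpa [add_mul] using add_mem h h'
  | add_right F F₁ F₂ _ _ _ h h' => simpa [mul_add] using add_mem h h'
  | smul_left c F F' _ _ h => simpa using Submodule.smul_mem _ c h
  | smul_right c F F' _ _ h => simpa using Submodule.smul_mem _ c h

lemma mem_coordRing_of_mem_regularMaps {F : G → ℂ} (hF : F ∈ regularMaps G ℂ) :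
    F ∈ coordRing G := by
  induction hF using Submodule.span_induction with
  | mem F h =>
    obtain ⟨a, ha, x, rfl⟩ := h
    convert (coordRing G).smul_mem ha x using 1
    ext g
    simp [mul_comm]
  | zero => exact zero_mem _
  | add F F' _ _ h h' => exact add_mem h h'
  | smul c F _ h => exact (coordRing G).smul_mem h c

/-- A finite sum `∑ aᵢ • xᵢ` takes values in the span of the `xᵢ`. This is the source of local
finiteness of the actions. -/
lemma exists_finiteDimensional_of_mem_regularMaps {F : G → M} (hF : F ∈ regularMaps G M) :
    ∃ U : Submodule ℂ M, FiniteDimensional ℂ U ∧ ∀ g, F g ∈ U := by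
  induction hF using Submodule.span_induction with
  | mem F h =>
    obtain ⟨a, -, x, rfl⟩ := h
    exact ⟨ℂ ∙ x, inferInstance, fun g =>
      Submodule.smul_mem _ _ (Submodule.mem_span_singleton_self x)⟩
  | zero => exact ⟨⊥, inferInstance, fun _ => zero_mem _⟩
  | add F F' _ _ h h' =>
    obtain ⟨U, _, h⟩ := h
    obtain ⟨U', _, h'⟩ := h'
    exact ⟨U ⊔ U', inferInstance, fun g => Submodule.add_mem_sup (h g) (h' g)⟩
  | smul c F _ h =>
    obtain ⟨U, hU, h⟩ := h
    exact ⟨U, hU, fun g => U.smul_mem c (h g)⟩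

lemma mem_regularMaps_of_subtype {U : Submodule ℂ M} {F : G → U}
    (hF : (fun g => (F g : M)) ∈ regularMaps G M) : F ∈ regularMaps G U := by
  -- A linear retraction of `M` onto `U` carries the regular map back into `U`.
  obtain ⟨p, hp⟩ := U.subtype.exists_leftInverse_of_injective U.ker_subtype
  convert linearMap_comp_mem_regularMaps p hF using 1
  ext1 g
  exact (LinearMap.congr_fun hp (F g)).symm

lemma pi_mem_regularMaps {ι : Type*} [Finite ι] {F : G → ι → M}
    (hF : ∀ i, (fun g => F g i) ∈ regularMaps G M) : F ∈ regularMaps G (ι → M) := by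
  classical
  have := Fintype.ofFinite ι
  have h : F = ∑ i, fun g => LinearMap.single ℂ (fun _ : ι => M) i (F g i) := by
    ext g j
    simp [Pi.single_apply]
  rw [h]
  exact sum_mem fun i _ => linearMap_comp_mem_regularMaps _ (hF i)

lemma eval_bind₁ {σ τ R : Type*} [CommSemiring R] (x : τ → R) (f : σ → MvPolynomial τ R)
    (p : MvPolynomial σ R) : MvPolynomial.eval x (MvPolynomial.bind₁ f p) =
      MvPolynomial.eval (fun i => MvPolynomial.eval x (f i)) p :=
  MvPolynomial.eval₂Hom_bind₁ _ _ _ _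

lemma restrictPoly_apply (p : MvPolynomial (Fin n) ℂ) (g : G) :
    restrictPoly G p g = MvPolynomial.eval (g : Fin n → ℂ) p := by
  simp [restrictPoly, MvPolynomial.aeval_eq_eval]

lemma eval_mem_coordRing (p : MvPolynomial (Fin n) ℂ) :
    (fun g : G => MvPolynomial.eval (g : Fin n → ℂ) p) ∈ coordRing G :=
  ⟨p, funext (restrictPoly_apply p)⟩

lemma IsPolyMap.comp_mem_coordRing {m : ℕ} {Z : Set (Fin m → ℂ)} {φ : G → Z}
    (hφ : IsPolyMap φ) {a : Z → ℂ} (ha : a ∈ coordRing Z) : a ∘ φ ∈ coordRing G := by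
  obtain ⟨P, hP⟩ := hφ
  obtain ⟨p, rfl⟩ := ha
  convert eval_mem_coordRing (MvPolynomial.bind₁ P p) using 1
  ext g
  rw [eval_bind₁, ← funext (hP g)]
  exact restrictPoly_apply p (φ g)

end RegularMaps

/-! ### Orbit spans and the lifting of invariants. -/

section Representation

variable {n : ℕ} {G : Set (Fin n → ℂ)} [Group G]

lemma IsAlgebraicGroup.comp_mul_right_mem_coordRing (hG : IsAlgebraicGroup G) (h : G) {a : G → ℂ}
    (ha : a ∈ coordRing G) : a ∘ (· * h) ∈ coordRing G := by
  obtain ⟨P, hP⟩ := hG.mul_isPolyMap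
  refine IsPolyMap.comp_mem_coordRing ⟨fun i => MvPolynomial.bind₁
    (Sum.elim MvPolynomial.X fun j => MvPolynomial.C ((h : Fin n → ℂ) j)) (P i), fun g i => ?_⟩ ha
  rw [hP g h i, eval_bind₁]
  congr 2
  ext (j | j) <;> simp

lemma IsAlgebraicGroup.comp_inv_mem_coordRing (hG : IsAlgebraicGroup G) {a : G → ℂ}
    (ha : a ∈ coordRing G) : a ∘ (·⁻¹) ∈ coordRing G :=
  hG.inv_isPolyMap.comp_mem_coordRing ha

variable {M N : Type*} [AddCommGroup M] [Module ℂ M] [AddCommGroup N] [Module ℂ N]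

/-- The subrepresentation spanned by the orbits of the elements of a set. -/
def orbitSpan (ρ : Representation ℂ G M) (s : Set M) : Subrepresentation ρ where
  toSubmodule := Submodule.span ℂ {y | ∃ g, ∃ x ∈ s, y = ρ g x}
  apply_mem_toSubmodule g y hy := by
    induction hy using Submodule.span_induction with
    | mem y h =>
      obtain ⟨h, x, hx, rfl⟩ := h
      exact Submodule.subset_span ⟨g * h, x, hx, by simp⟩
    | zero => simp
    | add y y' _ _ h h' => simpa using add_mem h h'
    | smul c y _ h => simpa using Submodule.smul_mem _ c h

lemma subset_orbitSpan (ρ : Representation ℂ G M) {s : Set M} {x : M} (hx : x ∈ s) :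
    x ∈ (orbitSpan ρ s).toSubmodule :=
  Submodule.subset_span ⟨1, x, hx, by simp⟩

lemma finiteDimensional_orbitSpan (ρ : Representation ℂ G M) {s : Set M} (hs : s.Finite)
    (h : ∀ x ∈ s, (fun g => ρ g x) ∈ regularMaps G M) :
    FiniteDimensional ℂ (orbitSpan ρ s).toSubmodule := by
  choose! U hU hxU using fun x hx => exists_finiteDimensional_of_mem_regularMaps (h x hx)
  have := hs.to_subtype
  have : ∀ x : s, FiniteDimensional ℂ (U x) := fun x => hU x x.2
  refine Submodule.finiteDimensional_of_le (S₂ := ⨆ x : s, U x) (Submodule.span_le.2 ?_)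
  rintro _ ⟨g, x, hx, rfl⟩
  exact Submodule.mem_iSup_of_mem (p := fun x : s => U x) ⟨x, hx⟩ (hxU x hx g)

/-- The orbit map of `ρ g x` is that of `x` precomposed with right translation by `g`, which
preserves `ℂ[G]`. -/
lemma regularMaps_of_mem_orbitSpan (hG : IsAlgebraicGroup G) (ρ : Representation ℂ G M) {s : Set M}
    (h : ∀ x ∈ s, (fun g => ρ g x) ∈ regularMaps G M) {y : M}
    (hy : y ∈ (orbitSpan ρ s).toSubmodule) : (fun g => ρ g y) ∈ regularMaps G M := by
  induction hy using Submodule.span_induction with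
  | mem y hy =>
    obtain ⟨g, x, hx, rfl⟩ := hy
    have := comp_mem_regularMaps (φ := (· * g))
      (fun a ha => hG.comp_mul_right_mem_coordRing g ha) (h x hx)
    simpa using this
  | zero =>
    simp only [map_zero]
    exact (regularMaps G M).zero_mem
  | add y y' _ _ h h' =>
    simp only [map_add]
    exact (regularMaps G M).add_mem h h'
  | smul c y _ h =>
    simp only [map_smul]
    exact (regularMaps G M).smul_mem c h

lemma toRepresentation_mem_regularMaps (hG : IsAlgebraicGroup G) (ρ : Representation ℂ G M)
    {s : Set M} (h : ∀ x ∈ s, (fun g => ρ g x) ∈ regularMaps G M)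
    (y : (orbitSpan ρ s).toSubmodule) :
    (fun g => (orbitSpan ρ s).toRepresentation g y) ∈
      regularMaps G (orbitSpan ρ s).toSubmodule :=
  mem_regularMaps_of_subtype (regularMaps_of_mem_orbitSpan hG ρ h y.2)

lemma isAlgebraicRep_orbitSpan (hG : IsAlgebraicGroup G) {M : Type} [AddCommGroup M] [Module ℂ M]
    (ρ : Representation ℂ G M) {s : Set M}
    (h : ∀ x ∈ s, (fun g => ρ g x) ∈ regularMaps G M) :
    IsAlgebraicRep (orbitSpan ρ s).toRepresentation :=
  fun v l => mem_coordRing_of_mem_regularMaps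
    (linearMap_comp_mem_regularMaps l (toRepresentation_mem_regularMaps hG ρ h v))

lemma IsAlgebraicRep.subrepresentation {M : Type} [AddCommGroup M] [Module ℂ M]
    {ρ : Representation ℂ G M} (hρ : IsAlgebraicRep ρ) (σ : Subrepresentation ρ) :
    IsAlgebraicRep σ.toRepresentation := by
  intro v l
  obtain ⟨l', hl'⟩ := l.exists_extend
  convert hρ v l' using 1
  ext g
  rw [← hl']
  rfl

/-- Under the Nagata hypothesis, an invariant hyperplane with trivial quotient has an invariant
complementary line. -/
lemma NagataHypothesis.exists_invariant_notMem (hN : NagataHypothesis G) :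
    ∀ (d : ℕ) {M : Type} [AddCommGroup M] [Module ℂ M] [FiniteDimensional ℂ M]
      {ρ : Representation ℂ G M}, Module.finrank ℂ M = d → IsAlgebraicRep ρ →
      ∀ N : Submodule ℂ M, Module.finrank ℂ (M ⧸ N) = 1 →
        (∀ (g : G) (v : M), ρ g v - v ∈ N) → ∃ v, v ∉ N ∧ ∀ g, ρ g v = v := by
  intro d
  induction d using Nat.strong_induction_on with
  | _ d ih =>
  intro M _ _ _ ρ hd hρ N hN1 hNt
  obtain ⟨H, P, hHP, hH1, hH, hP⟩ := hN M ρ hρ N hN1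
    (fun g v hv => by simpa using N.add_mem (hNt g v) hv) hNt
  -- The line `P` need not be transverse to `N`. If it lies inside `N`, then `H` still surjects onto
  -- `M / N`, so `H ∩ N` is a hyperplane in the smaller module `H`, again with trivial quotient, and
  -- induction on dimension applies.
  by_cases hPN : P ≤ N
  · let σ : Subrepresentation ρ := ⟨H, hH⟩
    have hlt : Module.finrank ℂ H < d := by
      have := H.finrank_quotient_add_finrank
      omega
    have hsurj : Function.Surjective (N.mkQ ∘ₗ H.subtype) := by
      rw [← LinearMap.range_eq_top, LinearMap.range_comp, Submodule.range_subtype, eq_top_iff,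
        ← N.range_mkQ, ← Submodule.map_top, ← hHP.sup_eq_top, Submodule.map_sup]
      refine sup_le le_rfl (le_trans ?_ bot_le)
      rw [Submodule.map_le_iff_le_comap]
      simpa using hPN
    have hker : LinearMap.ker (N.mkQ ∘ₗ H.subtype) = N.comap H.subtype := by
      rw [LinearMap.ker_comp, Submodule.ker_mkQ]
    have e := (N.mkQ ∘ₗ H.subtype).quotKerEquivOfSurjective hsurj
    rw [hker] at e
    obtain ⟨v, hv, hv'⟩ := ih _ hlt (ρ := σ.toRepresentation) rfl (hρ.subrepresentation σ)
      (N.comap H.subtype) (e.finrank_eq.trans hN1) fun g v => hNt g v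
    exact ⟨v, hv, fun g => congrArg Subtype.val (hv' g)⟩
  · obtain ⟨v, hvP, hvN⟩ := SetLike.not_le_iff_exists.1 hPN
    exact ⟨v, hvN, fun g => hP g v hvP⟩

/-- Invariants lift along linear maps that are equivariant on the orbit of a regular lift. -/
lemma NagataHypothesis.exists_invariant_lift (hG : IsAlgebraicGroup G) (hN : NagataHypothesis G)
    {M : Type} [AddCommGroup M] [Module ℂ M] (ρ : Representation ℂ G M) (φ : M →ₗ[ℂ] N) (v : M)
    (hv : (fun g => ρ g v) ∈ regularMaps G M) (hφ : ∀ g, φ (ρ g v) = φ v) :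
    ∃ v', (∀ g, ρ g v' = v') ∧ φ v' = φ v := by
  -- Otherwise the kernel on the orbit span would be everything, not a hyperplane.
  by_cases h0 : φ v = 0
  · exact ⟨0, by simp, by simp [h0]⟩
  have hreg : ∀ x ∈ ({v} : Set M), (fun g => ρ g x) ∈ regularMaps G M := by simpa using hv
  let σ := orbitSpan ρ {v}
  let W := σ.toSubmodule
  have : FiniteDimensional ℂ W := finiteDimensional_orbitSpan ρ (Set.finite_singleton v) hreg
  have hσ : IsAlgebraicRep σ.toRepresentation := isAlgebraicRep_orbitSpan hG ρ hreg
  have hinv : ∀ g, ∀ x ∈ W, φ (ρ g x) = φ x := by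
    intro g x hx
    induction hx using Submodule.span_induction with
    | mem x hx =>
      obtain ⟨h, _, rfl, rfl⟩ := hx
      rw [← Module.End.mul_apply, ← map_mul, hφ, hφ]
    | zero => simp
    | add x y _ _ h h' => simp [h, h']
    | smul c x _ h => simp [h]
  let ψ : W →ₗ[ℂ] N := φ ∘ₗ W.subtype
  have hrange : LinearMap.range ψ = ℂ ∙ φ v := by
    rw [LinearMap.range_comp, Submodule.range_subtype]
    apply le_antisymm
    · rw [Submodule.map_le_iff_le_comap]
      refine Submodule.span_le.2 ?_
      rintro _ ⟨g, _, rfl, rfl⟩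
      simp [hφ, Submodule.mem_span_singleton_self]
    · rw [Submodule.span_singleton_le_iff_mem]
      exact Submodule.mem_map_of_mem (subset_orbitSpan ρ rfl)
  obtain ⟨x, hx, hx'⟩ := hN.exists_invariant_notMem _ (ρ := σ.toRepresentation) rfl hσ
    (LinearMap.ker ψ)
    (by rw [ψ.quotKerEquivRange.finrank_eq, hrange, finrank_span_singleton h0])
    (fun g y => by
      rw [LinearMap.mem_ker, map_sub, sub_eq_zero]
      exact hinv g y y.2)
  obtain ⟨c, hc⟩ : ∃ c : ℂ, c • φ v = φ x :=
    Submodule.mem_span_singleton.1 (hrange ▸ LinearMap.mem_range_self ψ x)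
  have hc0 : c ≠ 0 := by
    rintro rfl
    exact hx (by simpa [ψ] using hc.symm)
  refine ⟨c⁻¹ • (x : M), fun g => ?_, ?_⟩
  · rw [map_smul]
    exact congrArg (c⁻¹ • ·) (congrArg Subtype.val (hx' g))
  · rw [map_smul, ← hc, smul_smul, inv_mul_cancel₀ hc0, one_smul]

end Representation

/-! ### Actions on algebras and their invariants. -/

section Invariants

variable {n : ℕ} {G : Set (Fin n → ℂ)} [Group G] {A : Type*} [CommRing A] [Algebra ℂ A]

/-- The representation underlying an action by algebra endomorphisms. -/
def algRep (α : G →* (A →ₐ[ℂ] A)) : Representation ℂ G A where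
  toFun g := (α g).toLinearMap
  map_one' := by rw [map_one]; rfl
  map_mul' g h := by rw [map_mul]; rfl

/-- The subalgebra of invariants of an action by algebra endomorphisms. -/
def fixedSubalgebra (α : G →* (A →ₐ[ℂ] A)) : Subalgebra ℂ A where
  carrier := {x | ∀ g, α g x = x}
  mul_mem' hx hy g := by rw [map_mul, hx g, hy g]
  add_mem' hx hy g := by rw [map_add, hx g, hy g]
  algebraMap_mem' r g := (α g).commutes r

end Invariants

/-! ### Hilbert's finiteness argument and symmetric algebras. -/

section Hilbert

open MvPolynomial

variable {n : ℕ} {G : Set (Fin n → ℂ)} [Group G] {ι : Type}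

lemma regularMaps_of_X (α : G →* (MvPolynomial ι ℂ →ₐ[ℂ] MvPolynomial ι ℂ))
    (hα : ∀ i, (fun g => α g (X i)) ∈ regularMaps G (MvPolynomial ι ℂ)) (p : MvPolynomial ι ℂ) :
    (fun g => α g p) ∈ regularMaps G (MvPolynomial ι ℂ) := by
  induction p using MvPolynomial.induction_on with
  | C c => simpa [← algebraMap_eq] using const_mem_regularMaps (G := G) (C c : MvPolynomial ι ℂ)
  | add p q hp hq =>
    simp only [map_add]
    exact add_mem hp hq
  | mul_X p i hp =>
    simp only [map_mul]
    exact mul_mem_regularMaps hp (hα i)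

lemma homogeneousComponent_map_of_isHomogeneous_X (f : MvPolynomial ι ℂ →ₐ[ℂ] MvPolynomial ι ℂ)
    (hf : ∀ i, (f (X i)).IsHomogeneous 1) (d : ℕ) (p : MvPolynomial ι ℂ) :
    homogeneousComponent d (f p) = f (homogeneousComponent d p) := by
  have hom : ∀ k q, q.IsHomogeneous k → (f q).IsHomogeneous k := by
    intro k q hq
    rw [aeval_unique f]
    exact one_mul k ▸ hq.aeval (f ∘ X) hf
  induction p using MvPolynomial.induction_on' with
  | monomial u a =>
    have h : (monomial u a : MvPolynomial ι ℂ).IsHomogeneous u.degree :=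
      isHomogeneous_monomial a rfl
    rw [homogeneousComponent_of_mem ((mem_homogeneousSubmodule _ _).2 h),
      homogeneousComponent_of_mem ((mem_homogeneousSubmodule _ _).2 (hom _ _ h))]
    split_ifs <;> simp
  | add p q hp hq => simp only [map_add, hp, hq]

attribute [local instance] MvPolynomial.gradedAlgebra in
lemma homogeneousComponent_mul_of_isHomogeneous {p q : MvPolynomial ι ℂ} {e : ℕ}
    (hq : q.IsHomogeneous e) (d : ℕ) :
    homogeneousComponent d (p * q) = if e ≤ d then homogeneousComponent (d - e) p * q else 0 := by
  simp only [← decomposition.decompose'_apply]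
  exact DirectSum.coe_decompose_mul_of_right_mem (homogeneousSubmodule ι ℂ) d (a := p)
    ((mem_homogeneousSubmodule _ _).2 hq)

/-- Hilbert's finiteness theorem for linear actions. -/
lemma fixedSubalgebra_fg [Finite ι] (hG : IsAlgebraicGroup G) (hN : NagataHypothesis G)
    (α : G →* (MvPolynomial ι ℂ →ₐ[ℂ] MvPolynomial ι ℂ))
    (hα : ∀ i, (fun g => α g (X i)) ∈ regularMaps G (MvPolynomial ι ℂ))
    (hhom : ∀ g i, (α g (X i)).IsHomogeneous 1) : (fixedSubalgebra α).FG := by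
  have hcomp : ∀ d, ∀ p ∈ fixedSubalgebra α, homogeneousComponent d p ∈ fixedSubalgebra α :=
    fun d p hp g => by
      rw [← homogeneousComponent_map_of_isHomogeneous_X _ (hhom g), hp g]
  let s : Set (MvPolynomial ι ℂ) := {p | p ∈ fixedSubalgebra α ∧ ∃ d, 0 < d ∧ p.IsHomogeneous d}
  -- Hilbert's basis theorem, with the ideal generators chosen inside `s`, hence invariant and
  -- homogeneous of positive degree.
  obtain ⟨T, hTs, hT⟩ := (Submodule.fg_span_iff_fg_span_finset_subset s).1
    (IsNoetherian.noetherian (Submodule.span (MvPolynomial ι ℂ) s))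
  have hTα : ∀ t : T, (t : MvPolynomial ι ℂ) ∈ fixedSubalgebra α := fun t => (hTs t.2).1
  choose deg hdeg0 hdeg using fun t : T => (hTs t.2).2
  have key : ∀ d, ∀ p ∈ fixedSubalgebra α, p.IsHomogeneous d →
      p ∈ Algebra.adjoin ℂ (T : Set (MvPolynomial ι ℂ)) := by
    intro d
    induction d using Nat.strong_induction_on with
    | _ d ih =>
    intro p hp hpd
    rcases Nat.eq_zero_or_pos d with rfl | hd
    · rw [← homogeneousComponent_eq_self hpd, homogeneousComponent_zero]
      exact Subalgebra.algebraMap_mem _ _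
    have hpT : p ∈ Submodule.span (MvPolynomial ι ℂ) (T : Set (MvPolynomial ι ℂ)) :=
      hT ▸ Submodule.subset_span ⟨hp, d, hd, hpd⟩
    obtain ⟨a, ha⟩ : ∃ a : T → MvPolynomial ι ℂ, ∑ t, a t * (t : MvPolynomial ι ℂ) = p := by
      obtain ⟨a, ha⟩ := Submodule.mem_span_finset'.1 hpT
      exact ⟨a, ha⟩
    let φ : (T → MvPolynomial ι ℂ) →ₗ[ℂ] MvPolynomial ι ℂ :=
      ∑ t : T, LinearMap.mulRight ℂ (t : MvPolynomial ι ℂ) ∘ₗ LinearMap.proj t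
    have hφ : ∀ a, φ a = ∑ t, a t * (t : MvPolynomial ι ℂ) := fun a => by simp [φ]
    -- The action on tuples is componentwise. Since each `t` is invariant, `φ` is equivariant, and
    -- so constant on the orbit of `a` because `p` is invariant.
    let ρ : Representation ℂ G (T → MvPolynomial ι ℂ) :=
      { toFun g := LinearMap.pi fun t => (α g).toLinearMap ∘ₗ LinearMap.proj t
        map_one' := by ext : 3; simp
        map_mul' g h := by ext : 3; simp }
    have hρ : ∀ g a t, ρ g a t = α g (a t) := fun _ _ _ => rfl
    obtain ⟨b, hb, hbp⟩ := hN.exists_invariant_lift hG ρ φ a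
      (pi_mem_regularMaps fun t => regularMaps_of_X α hα (a t)) fun g => by
        rw [hφ, hφ, ha]
        calc ∑ t, ρ g a t * (t : MvPolynomial ι ℂ)
            = α g (∑ t, a t * (t : MvPolynomial ι ℂ)) := by
              simp only [map_sum, map_mul, hρ]
              exact Finset.sum_congr rfl fun t _ => by rw [hTα t g]
          _ = p := by rw [ha, hp g]
    rw [hφ, hφ, ha] at hbp
    -- In degree `d`, the coefficient of `t` becomes its component of degree `d - deg t`, still
    -- invariant and of degree below `d`.
    rw [← homogeneousComponent_eq_self hpd, ← hbp, map_sum]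
    refine sum_mem fun t _ => ?_
    rw [homogeneousComponent_mul_of_isHomogeneous (hdeg t)]
    split_ifs with h
    · refine mul_mem (ih _ (Nat.sub_lt hd (hdeg0 t)) _ (hcomp _ _ fun g => ?_)
        (homogeneousComponent_isHomogeneous _ _)) (Algebra.subset_adjoin t.2)
      exact congrFun (hb g) t
    · exact zero_mem _
  refine ⟨T, le_antisymm (Algebra.adjoin_le fun t ht => (hTs ht).1) fun p hp => ?_⟩
  rw [← sum_homogeneousComponent p]
  exact sum_mem fun d _ => key d _ (hcomp d p hp) (homogeneousComponent_isHomogeneous _ _)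

variable {W : Type*} [AddCommGroup W] [Module ℂ W]

/-- The elements of `W` as linear polynomials in the vectors of a basis. -/
noncomputable def linearForm (b : Module.Basis ι ℂ W) : W →ₗ[ℂ] MvPolynomial ι ℂ :=
  b.constr ℂ X

lemma linearForm_basis (b : Module.Basis ι ℂ W) (i : ι) : linearForm b (b i) = X i :=
  b.constr_basis ℂ _ i

lemma isHomogeneous_linearForm [Finite ι] (b : Module.Basis ι ℂ W) (w : W) :
    (linearForm b w).IsHomogeneous 1 := by
  have := Fintype.ofFinite ι
  rw [linearForm, b.constr_apply_fintype ℂ]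
  exact IsHomogeneous.sum _ _ _ fun i _ => (homogeneousSubmodule ι ℂ 1).smul_mem _
    (isHomogeneous_X ℂ i)

/-- The universal property of `Sym W`, modelled as polynomials in a basis. -/
lemma aeval_linearForm (b : Module.Basis ι ℂ W) {A : Type*} [CommRing A] [Algebra ℂ A]
    (L : W →ₗ[ℂ] A) (w : W) : aeval (fun i => L (b i)) (linearForm b w) = L w := by
  have : (aeval (fun i => L (b i))).toLinearMap ∘ₗ linearForm b = L :=
    b.ext fun i => by simp [linearForm_basis]
  exact LinearMap.congr_fun this w

/-- The action on the symmetric algebra of a representation, in terms of a basis. -/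
noncomputable def symAction (σ : Representation ℂ G W) (b : Module.Basis ι ℂ W) :
    G →* (MvPolynomial ι ℂ →ₐ[ℂ] MvPolynomial ι ℂ) where
  toFun g := aeval fun i => (linearForm b ∘ₗ σ g) (b i)
  map_one' := by
    ext i : 1
    simp [linearForm_basis]
  map_mul' g h := by
    ext i : 1
    rw [AlgHom.mul_apply, aeval_X, aeval_X, LinearMap.comp_apply, LinearMap.comp_apply,
      aeval_linearForm, LinearMap.comp_apply, map_mul, Module.End.mul_apply]

lemma symAction_X (σ : Representation ℂ G W) (b : Module.Basis ι ℂ W) (g : G) (i : ι) :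
    symAction σ b g (X i) = linearForm b (σ g (b i)) :=
  aeval_X _ i

end Hilbert

/-! ### The translation action on functions on `Z`. -/

section Translation

open MvPolynomial

variable {n m : ℕ} {G : Set (Fin n → ℂ)} {Z : Set (Fin m → ℂ)}

/-- The coordinate functions generate the coordinate ring. -/
lemma restrictPoly_eq_aeval : restrictPoly Z = aeval fun i (z : Z) => (z : Fin m → ℂ) i := by
  ext i z
  simp [restrictPoly_apply]

/-- Separation of variables: a polynomial in `g` and `z` is a finite sum of products `a g * f z`. -/
lemma eval_sumElim_mem_regularMaps (q : MvPolynomial (Fin n ⊕ Fin m) ℂ) :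
    (fun (g : G) (z : Z) => eval (Sum.elim (g : Fin n → ℂ) (z : Fin m → ℂ)) q) ∈
      regularMaps G (Z → ℂ) := by
  induction q using MvPolynomial.induction_on with
  | C c => simpa using const_mem_regularMaps (G := G) (fun _ : Z => c)
  | add p q hp hq =>
    simp only [map_add]
    exact add_mem hp hq
  | mul_X p i hp =>
    simp only [map_mul]
    refine mul_mem_regularMaps hp ?_
    rcases i with i | i
    · convert smul_mem_regularMaps (eval_mem_coordRing (X i : MvPolynomial (Fin n) ℂ))
        (1 : Z → ℂ) using 1
      ext g z
      simp
    · simpa using const_mem_regularMaps (G := G) (fun z : Z => (z : Fin m → ℂ) i)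

variable [Group G] [MulAction G Z]

/-- The action of `G` on the functions on `Z`, by `(g • f) z = f (g⁻¹ • z)`. -/
def translation (G : Set (Fin n → ℂ)) [Group G] (Z : Set (Fin m → ℂ)) [MulAction G Z] :
    G →* ((Z → ℂ) →ₐ[ℂ] (Z → ℂ)) where
  toFun g :=
    { toFun := fun f z => f (g⁻¹ • z)
      map_one' := rfl
      map_mul' := fun _ _ => rfl
      map_zero' := rfl
      map_add' := fun _ _ => rfl
      commutes' := fun _ => rfl }
  map_one' := by
    ext f z
    change f ((1 : G)⁻¹ • z) = f z
    rw [inv_one, one_smul]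
  map_mul' g h := by
    ext f z
    change f ((g * h)⁻¹ • z) = f (h⁻¹ • g⁻¹ • z)
    rw [mul_inv_rev, mul_smul]

lemma translation_apply (g : G) (f : Z → ℂ) (z : Z) : translation G Z g f z = f (g⁻¹ • z) := rfl

lemma IsAffineGVariety.translation_mem_coordRing (hZ : IsAffineGVariety G Z) (g : G) {f : Z → ℂ}
    (hf : f ∈ coordRing Z) : translation G Z g f ∈ coordRing Z := by
  obtain ⟨P, hP⟩ := hZ.smul_isPolyMap
  refine IsPolyMap.comp_mem_coordRing (φ := fun z => g⁻¹ • z) ⟨fun i => bind₁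
    (Sum.elim (fun j => C (((g⁻¹ : G) : Fin n → ℂ) j)) X) (P i), fun z i => ?_⟩ hf
  rw [hP g⁻¹ z i, eval_bind₁]
  congr 2
  ext (j | j) <;> simp

lemma IsAffineGVariety.translation_mem_regularMaps (hG : IsAlgebraicGroup G)
    (hZ : IsAffineGVariety G Z) {f : Z → ℂ} (hf : f ∈ coordRing Z) :
    (fun g => translation G Z g f) ∈ regularMaps G (Z → ℂ) := by
  obtain ⟨P, hP⟩ := hZ.smul_isPolyMap
  obtain ⟨p, rfl⟩ := hf
  convert comp_mem_regularMaps (fun a ha => hG.comp_inv_mem_coordRing ha)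
    (eval_sumElim_mem_regularMaps (G := G) (Z := Z) (bind₁ P p)) using 1
  ext g z
  rw [translation_apply, eval_bind₁, ← funext (hP g⁻¹ z)]
  exact restrictPoly_apply p _

end Translation

/-! ### Reduction to a linear action. -/

theorem mainTheorem8 {n m : ℕ} (G : Set (Fin n → ℂ)) [Group G] (hG : IsAlgebraicGroup G)
    (hN : NagataHypothesis G) (Z : Set (Fin m → ℂ)) [MulAction G Z]
    (hZ : IsAffineGVariety G Z) :
    Algebra.FiniteType ℂ (invariantRing G Z) := by
  let x : Fin m → Z → ℂ := fun i z => (z : Fin m → ℂ) i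
  have hx : ∀ i, x i ∈ coordRing Z := fun i => ⟨MvPolynomial.X i, by
    simp [restrictPoly_eq_aeval, x]⟩
  let ρ := algRep (translation G Z)
  have hreg : ∀ f ∈ Set.range x, (fun g => ρ g f) ∈ regularMaps G (Z → ℂ) := by
    rintro _ ⟨i, rfl⟩
    exact hZ.translation_mem_regularMaps hG (hx i)
  let W := orbitSpan ρ (Set.range x)
  have : FiniteDimensional ℂ W.toSubmodule :=
    finiteDimensional_orbitSpan ρ (Set.finite_range x) hreg
  have hWle : W.toSubmodule ≤ Subalgebra.toSubmodule (coordRing Z) := by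
    refine Submodule.span_le.2 ?_
    rintro _ ⟨g, _, ⟨i, rfl⟩, rfl⟩
    exact hZ.translation_mem_coordRing g (hx i)
  let b := Module.finBasis ℂ W.toSubmodule
  let α := symAction W.toRepresentation b
  let φ : MvPolynomial _ ℂ →ₐ[ℂ] (Z → ℂ) :=
    MvPolynomial.aeval fun i => W.toSubmodule.subtype (b i)
  have hφ : ∀ w, φ (linearForm b w) = w := aeval_linearForm b W.toSubmodule.subtype
  have hequiv : ∀ g p, φ (α g p) = translation G Z g (φ p) := by
    intro g p
    have : φ.comp (α g) = (translation G Z g).comp φ := by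
      ext i : 1
      rw [AlgHom.comp_apply, AlgHom.comp_apply, symAction_X, hφ, MvPolynomial.aeval_X]
      rfl
    exact DFunLike.congr_fun this p
  have hrange : ∀ p, φ p ∈ coordRing Z := by
    intro p
    have : φ p ∈ φ.range := ⟨p, rfl⟩
    rw [← Algebra.adjoin_range_eq_range_aeval] at this
    refine Algebra.adjoin_le ?_ this
    rintro _ ⟨i, rfl⟩
    exact hWle (b i).2
  have hsurj : ∀ f ∈ coordRing Z, ∃ p, φ p = f := by
    rintro _ ⟨p, rfl⟩
    -- Each coordinate function lies in `W`, so it is the image of its own linear form; substituting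
    -- these forms into `p` gives a preimage.
    refine ⟨MvPolynomial.aeval
      (fun i => linearForm b ⟨x i, subset_orbitSpan ρ (Set.mem_range_self i)⟩) p, ?_⟩
    rw [← AlgHom.comp_apply, MvPolynomial.comp_aeval]
    simp only [hφ]
    exact (DFunLike.congr_fun restrictPoly_eq_aeval p).symm
  have hα : ∀ i, (fun g => α g (MvPolynomial.X i)) ∈ regularMaps G (MvPolynomial _ ℂ) := by
    intro i
    simp only [α, symAction_X]
    exact linearMap_comp_mem_regularMaps (linearForm b)
      (toRepresentation_mem_regularMaps hG ρ hreg (b i))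
  have hfg : (fixedSubalgebra α).FG := fixedSubalgebra_fg hG hN α hα fun g i => by
    rw [symAction_X]
    exact isHomogeneous_linearForm b _
  rw [← Subalgebra.fg_iff_finiteType]
  refine Subalgebra.fg_of_fg_map _ (coordRing Z).val Subtype.val_injective ?_
  convert hfg.map φ using 1
  ext f
  constructor
  · rintro ⟨f, hf, rfl⟩
    obtain ⟨p, hp⟩ := hsurj f f.2
    -- The preimage `p` need not be invariant, but its image is, so lifting replaces it by an
    -- invariant `q`.
    obtain ⟨q, hq, hqp⟩ := hN.exists_invariant_lift hG (algRep α) φ.toLinearMap p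
      (regularMaps_of_X α hα p) fun g => by
        change φ (α g p) = φ p
        rw [hequiv, hp]
        ext z
        exact hf g⁻¹ z
    exact ⟨q, hq, hqp.trans hp⟩
  · rintro ⟨p, hp, rfl⟩
    refine ⟨⟨φ p, hrange p⟩, fun g z => ?_, rfl⟩
    have := congrFun (hequiv g⁻¹ p) z
    rw [hp g⁻¹, translation_apply, inv_inv] at this
    exact this.symm
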